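/- Let $H$ be a separable infinite-dimensional complex Hilbert space and let $T\in B(H)$ be a bounded linear operator. For a bounded operator $S$ on a Hilbert space $X$ write $\alpha(S)=\dim N(S)$ and $\beta(S)=\dim X/R(S)$, with values in $\{0,1,2,\dots,\infty\}$. The operator $T$ is called lower semi-Browder if $\beta(T)<\infty$ and $T$ has finite descent, i.e. $R(T^k)=R(T^{k+1})$ for some $k\ge 0$. Then $T$ is lower semi-Browder if and only if there is an orthogonal decomposition $H=H_1\oplus H_2$ with $\dim H_2<\infty$ with respect to which $$T=\begin{pmatrix}T_1&T_{12}\\0&T_2\end{pmatrix},$$ where $T_1\in B(H_1)$ is right invertible, $T_{12}\in B(H_2,H_1)$, and $T_2\in B(H_2)$ is nilpotent. Moreover, for every such decomposition the limit $b.s.\_mul(T)=\lim_{k\to\infty}\alpha(T^k)/k$ exists in $[0,\infty]$ and $$\alpha(T_1)=b.s.\_mul(T)=\operatorname{ind}(T),$$ where $\operatorname{ind}(T)=\alpha(T)-\beta(T)\in\mathbb Z\cup\{+\infty\}$. -/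

import Mathlib

open Filter Topology

noncomputable section

namespace SamuelMultiplicity

variable {E : Type*} [NormedAddCommGroup E] [NormedSpace ℂ E]

/-- The nullity `α(T) = dim N(T)`, an element of `{0, 1, 2, …, ∞}`. -/
def nullity (T : E →L[ℂ] E) : ℕ∞ :=
  Cardinal.toENat (Module.rank ℂ (LinearMap.ker T.toLinearMap))

/-- The deficiency `β(T) = dim E / R(T)`, an element of `{0, 1, 2, …, ∞}`. -/
def deficiency (T : E →L[ℂ] E) : ℕ∞ :=
  Cardinal.toENat (Module.rank ℂ (E ⧸ LinearMap.range T.toLinearMap))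

/-- The descent of `T`: the least `k` with `R(T ^ k) = R(T ^ (k + 1))`, and `∞` if there is
no such `k`. -/
def descent (T : E →L[ℂ] E) : ℕ∞ :=
  ⨅ k ∈ {k : ℕ | LinearMap.range (T ^ k).toLinearMap = LinearMap.range (T ^ (k + 1)).toLinearMap},
    (k : ℕ∞)

/-- `T` is lower semi-Fredholm: `β(T) < ∞`. -/
def IsLowerSemiFredholm (T : E →L[ℂ] E) : Prop :=
  deficiency T < ⊤

/-- `T` is lower semi-Browder: it is lower semi-Fredholm and has finite descent. -/
def IsLowerSemiBrowder (T : E →L[ℂ] E) : Prop :=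
  IsLowerSemiFredholm T ∧ descent T < ⊤

/-- The index `α(T) - β(T)` with values in the extended reals. It is meaningful only for
semi-Fredholm operators, for which `α(T)` and `β(T)` are not both infinite. -/
def index (T : E →L[ℂ] E) : EReal :=
  (nullity T : EReal) - (deficiency T : EReal)

/-- The sequence `α(T ^ k) / k`, in the extended reals (only `k ≥ 1` matters). -/
def nullityQuotient (T : E →L[ℂ] E) (k : ℕ) : EReal :=
  (nullity (T ^ k) : EReal) / (k : EReal)

/-- The backward shift Samuel multiplicity `lim_{k → ∞} α(T ^ k) / k`. -/
def bsMul (T : E →L[ℂ] E) : EReal :=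
  limUnder atTop (nullityQuotient T)

/-- `T` is right invertible in the algebra of bounded operators. -/
def IsRightInvertible (T : E →L[ℂ] E) : Prop :=
  ∃ S : E →L[ℂ] E, T * S = 1

/-- `H = H₁ ⊕ H₂` is an orthogonal decomposition (so `H₁` and `H₂` are each other's orthogonal
complements, hence closed) with respect to which `T` is the upper triangular operator matrix
with diagonal entries `T₁`, `T₂` and upper right entry `T₁₂`. -/
structure IsUpperTriangularForm {H : Type*} [NormedAddCommGroup H] [InnerProductSpace ℂ H]
    (T : H →L[ℂ] H) (H₁ H₂ : Submodule ℂ H)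
    (T₁ : H₁ →L[ℂ] H₁) (T₁₂ : H₂ →L[ℂ] H₁) (T₂ : H₂ →L[ℂ] H₂) : Prop where
  orthogonal : H₁ ⟂ H₂
  sup_eq_top : H₁ ⊔ H₂ = ⊤
  apply_add : ∀ (x : H₁) (y : H₂),
    T ((x : H) + (y : H)) = ((T₁ x + T₁₂ y : H₁) : H) + ((T₂ y : H₂) : H)

end SamuelMultiplicity

end

/-! ### Kernels and cokernels of compositions, powers and extensions. -/

section LinearAlgebra

universe u v

variable {K : Type v} [Field K]

/-! If the ranges stabilise at `M = R(T ^ k)`, then `T` maps `M` onto `M`. Finite deficiency passes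
to powers, so `M` has finite codimension and is therefore closed. In a Hilbert space the surjection
on `M` has a bounded right inverse, and the compression of `T` to `Mᗮ` is nilpotent because `T ^ k`
sends everything into `M`.

Conversely, a triangular form makes `T` an extension of `T₂` (acting on `H/H₁ ≅ H₂`) by the
surjective `T₁`. The snake lemma has no connecting map here, so `α(T ^ k) = α(T₂ ^ k) + k α(T₁)` and
`β(T) = β(T₂) = α(T₂)`, the last by finite dimension. The case `k = 1` gives the index; dividing by
`k` gives the limit, since `α(T₂ ^ k) ≤ dim H₂ < ∞`. -/

theorem LinearMap.rank_ker_comp_of_surjective {A B C : Type u}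
    [AddCommGroup A] [Module K A] [AddCommGroup B] [Module K B] [AddCommGroup C] [Module K C]
    (g : B →ₗ[K] C) (f : A →ₗ[K] B) (hf : Function.Surjective f) :
    Module.rank K (LinearMap.ker (g ∘ₗ f)) =
      Module.rank K (LinearMap.ker g) + Module.rank K (LinearMap.ker f) := by
  let r : LinearMap.ker (g ∘ₗ f) →ₗ[K] LinearMap.ker g :=
    f.restrict (fun x hx => by simpa using hx)
  have hr : LinearMap.range r = ⊤ := by
    rw [LinearMap.range_eq_top]
    rintro ⟨y, hy⟩
    obtain ⟨x, rfl⟩ := hf y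
    exact ⟨⟨x, by simpa using hy⟩, rfl⟩
  have hle : LinearMap.ker f ≤ LinearMap.ker (g ∘ₗ f) := LinearMap.ker_le_ker_comp f g
  have hk : LinearMap.ker r = (LinearMap.ker f).comap (LinearMap.ker (g ∘ₗ f)).subtype := by
    ext x
    simp [r, Subtype.ext_iff]
  have h := LinearMap.rank_range_add_rank_ker r
  rw [hr, rank_top, hk, (Submodule.comapSubtypeEquivOfLe hle).rank_eq] at h
  exact h.symm

theorem Module.End.rank_ker_pow_of_surjective {A : Type u} [AddCommGroup A] [Module K A]
    (f : Module.End K A) (hf : Function.Surjective f) (k : ℕ) :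
    Module.rank K (LinearMap.ker (f ^ k)) = k * Module.rank K (LinearMap.ker f) := by
  induction k with
  | zero => simp [Module.End.one_eq_id]
  | succ k ih =>
    rw [pow_succ, Module.End.mul_eq_comp, LinearMap.rank_ker_comp_of_surjective _ _ hf, ih]
    push_cast
    ring

section ShortExact

variable {A B C : Type u} [AddCommGroup A] [Module K A] [AddCommGroup B] [Module K B]
  [AddCommGroup C] [Module K C] {i : A →ₗ[K] B} {p : B →ₗ[K] C}
  {fA : Module.End K A} {fB : Module.End K B} {fC : Module.End K C}

/-- Kernel part of the snake lemma: the connecting map lands in the cokernel of `fA`, which is zero.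
-/
theorem LinearMap.rank_ker_of_exact (hi : Function.Injective i) (hp : Function.Surjective p)
    (hip : LinearMap.range i = LinearMap.ker p) (hA : fB ∘ₗ i = i ∘ₗ fA) (hC : p ∘ₗ fB = fC ∘ₗ p)
    (hfA : Function.Surjective fA) :
    Module.rank K (LinearMap.ker fB) =
      Module.rank K (LinearMap.ker fC) + Module.rank K (LinearMap.ker fA) := by
  have hA' (x) : fB (i x) = i (fA x) := LinearMap.congr_fun hA x
  have hC' (x) : p (fB x) = fC (p x) := LinearMap.congr_fun hC x
  have hpi (x) : p (i x) = 0 := by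
    rw [← LinearMap.mem_ker, ← hip]
    exact ⟨x, rfl⟩
  let r : LinearMap.ker fB →ₗ[K] LinearMap.ker fC :=
    p.restrict (fun x hx => by rw [LinearMap.mem_ker] at hx ⊢; rw [← hC', hx, map_zero])
  have hr : LinearMap.range r = ⊤ := by
    rw [LinearMap.range_eq_top]
    rintro ⟨z, hz⟩
    obtain ⟨y, rfl⟩ := hp z
    -- A lift `y` of `z` need not lie in `ker fB`; subtracting a preimage under `fA` of the defect
    -- corrects it.
    have hy : fB y ∈ LinearMap.range i := by
      rw [hip, LinearMap.mem_ker, hC']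
      exact hz
    obtain ⟨a, ha⟩ := hy
    obtain ⟨x, rfl⟩ := hfA a
    refine ⟨⟨y - i x, ?_⟩, Subtype.ext ?_⟩
    · rw [LinearMap.mem_ker, map_sub, hA', ha, sub_self]
    · change p (y - i x) = p y
      rw [map_sub, hpi, sub_zero]
  let j : LinearMap.ker fA →ₗ[K] LinearMap.ker fB :=
    i.restrict (fun x hx => by rw [LinearMap.mem_ker] at hx ⊢; rw [hA', hx, map_zero])
  have hj : Function.Injective j := fun x y hxy =>
    Subtype.ext (hi (congrArg Subtype.val hxy))
  have hk : LinearMap.ker r = LinearMap.range j := by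
    ext ⟨x, hx⟩
    constructor
    · intro h
      have hx' : x ∈ LinearMap.range i := by
        rw [hip]
        exact congrArg Subtype.val h
      obtain ⟨a, rfl⟩ := hx'
      refine ⟨⟨a, hi ?_⟩, rfl⟩
      rw [← hA', map_zero]
      exact hx
    · rintro ⟨a, ha⟩
      rw [← ha]
      exact Subtype.ext (hpi a)
  have h := LinearMap.rank_range_add_rank_ker r
  rw [hr, rank_top, hk, ← (LinearEquiv.ofInjective j hj).rank_eq] at h
  exact h.symm

theorem LinearMap.rank_quotient_range_of_exact (hp : Function.Surjective p)
    (hip : LinearMap.range i = LinearMap.ker p) (hA : fB ∘ₗ i = i ∘ₗ fA) (hC : p ∘ₗ fB = fC ∘ₗ p)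
    (hfA : Function.Surjective fA) :
    Module.rank K (B ⧸ LinearMap.range fB) = Module.rank K (C ⧸ LinearMap.range fC) := by
  have hker : LinearMap.ker ((LinearMap.range fC).mkQ ∘ₗ p) = LinearMap.range fB := by
    have h1 : LinearMap.range fC = (LinearMap.range fB).map p := by
      rw [← LinearMap.range_comp, hC, LinearMap.range_comp, LinearMap.range_eq_top.2 hp,
        Submodule.map_top]
    have h2 : LinearMap.ker p ≤ LinearMap.range fB := by
      rw [← hip]
      rintro _ ⟨a, rfl⟩
      obtain ⟨x, rfl⟩ := hfA a
      exact ⟨i x, LinearMap.congr_fun hA x⟩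
    rw [LinearMap.ker_comp, Submodule.ker_mkQ, h1, Submodule.comap_map_eq, sup_eq_left.2 h2]
  exact ((Submodule.quotEquivOfEq _ _ hker.symm).trans
    (LinearMap.quotKerEquivOfSurjective ((LinearMap.range fC).mkQ ∘ₗ p)
      ((Submodule.mkQ_surjective _).comp hp))).rank_eq

end ShortExact

theorem LinearMap.rank_ker_eq_rank_quotient_range {C : Type u} [AddCommGroup C] [Module K C]
    [FiniteDimensional K C] (f : Module.End K C) :
    Module.rank K (LinearMap.ker f) = Module.rank K (C ⧸ LinearMap.range f) := by
  have h := (LinearMap.rank_range_add_rank_ker f).trans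
    (Submodule.rank_quotient_add_rank (LinearMap.range f)).symm
  rw [add_comm] at h
  exact Cardinal.eq_of_add_eq_add_right h (Module.rank_lt_aleph0 K _)

/-- The sequence `B/R(f) → C/R(gf) → C/R(g)` is exact in the middle, and its outer terms are
finite-dimensional. -/
theorem LinearMap.finite_quotient_range_comp {A B C : Type u}
    [AddCommGroup A] [Module K A] [AddCommGroup B] [Module K B] [AddCommGroup C] [Module K C]
    (g : B →ₗ[K] C) (f : A →ₗ[K] B) [Module.Finite K (C ⧸ LinearMap.range g)]
    [Module.Finite K (B ⧸ LinearMap.range f)] :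
    Module.Finite K (C ⧸ LinearMap.range (g ∘ₗ f)) := by
  let q : (C ⧸ LinearMap.range (g ∘ₗ f)) →ₗ[K] (C ⧸ LinearMap.range g) :=
    Submodule.factor (LinearMap.range_comp_le_range f g)
  let m : (B ⧸ LinearMap.range f) →ₗ[K] (C ⧸ LinearMap.range (g ∘ₗ f)) :=
    Submodule.mapQ _ _ g (by rintro _ ⟨x, rfl⟩; exact ⟨x, rfl⟩)
  have hk : LinearMap.ker q ≤ LinearMap.range m := by
    intro x hx
    obtain ⟨c, rfl⟩ := Submodule.Quotient.mk_surjective _ x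
    have hc : c ∈ LinearMap.range g := (Submodule.Quotient.mk_eq_zero _).1 hx
    obtain ⟨b, rfl⟩ := hc
    exact ⟨Submodule.Quotient.mk b, rfl⟩
  have : Module.Finite K (LinearMap.ker q) := Submodule.finiteDimensional_of_le hk
  have : Module.Finite K ((C ⧸ LinearMap.range (g ∘ₗ f)) ⧸ LinearMap.ker q) :=
    Module.Finite.equiv q.quotKerEquivRange.symm
  exact Module.Finite.of_submodule_quotient (LinearMap.ker q)

theorem Module.End.finite_quotient_range_pow {A : Type u} [AddCommGroup A] [Module K A]
    (f : Module.End K A) [Module.Finite K (A ⧸ LinearMap.range f)] (k : ℕ) :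
    Module.Finite K (A ⧸ LinearMap.range (f ^ k)) := by
  induction k with
  | zero =>
    rw [pow_zero, Module.End.one_eq_id, LinearMap.range_id]
    infer_instance
  | succ k ih =>
    rw [pow_succ, Module.End.mul_eq_comp]
    exact LinearMap.finite_quotient_range_comp _ _

end LinearAlgebra

/-! ### Closed ranges and right inverses in Hilbert space. -/

section Hilbert

variable {H G : Type*} [NormedAddCommGroup H] [InnerProductSpace ℂ H] [CompleteSpace H]
  [NormedAddCommGroup G] [NormedSpace ℂ G]

namespace ContinuousLinearMap

theorem exists_eq_apply_ker_orthogonal (f : H →L[ℂ] G) (x : H) :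
    ∃ y : f.kerᗮ, f y = f x := by
  have : CompleteSpace f.ker := f.isClosed_ker.completeSpace_coe
  have hx : x ∈ f.ker ⊔ f.kerᗮ := by
    rw [Submodule.sup_orthogonal_of_hasOrthogonalProjection]
    trivial
  obtain ⟨y, hy, z, hz, rfl⟩ := Submodule.mem_sup.1 hx
  refine ⟨⟨z, hz⟩, ?_⟩
  rw [map_add, show f y = 0 from hy, zero_add]

omit [CompleteSpace H] in
theorem ker_comp_subtypeL_ker_orthogonal (f : H →L[ℂ] G) :
    (f ∘L f.kerᗮ.subtypeL).ker = ⊥ := by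
  rw [Submodule.eq_bot_iff]
  rintro ⟨x, hx⟩ h
  exact Subtype.ext ((Submodule.orthogonal_disjoint f.ker).le_bot ⟨h, hx⟩)

theorem range_comp_subtypeL_ker_orthogonal (f : H →L[ℂ] G) :
    (f ∘L f.kerᗮ.subtypeL).range = f.range := by
  ext y
  constructor
  · rintro ⟨x, rfl⟩
    exact ⟨x, rfl⟩
  · rintro ⟨x, rfl⟩
    obtain ⟨z, hz⟩ := f.exists_eq_apply_ker_orthogonal x
    exact ⟨z, hz⟩

/-- Restricting to `f.kerᗮ` makes `f` injective without changing its range, which has a closed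
finite-dimensional complement. -/
theorem isClosed_range_of_finite_quotient [CompleteSpace G] (f : H →L[ℂ] G)
    [Module.Finite ℂ (G ⧸ f.range)] : IsClosed (f.range : Set G) := by
  obtain ⟨F, hF⟩ := Submodule.exists_isCompl f.range
  have : FiniteDimensional ℂ F :=
    Module.Finite.equiv (Submodule.quotientEquivOfIsCompl _ _ hF)
  rw [← range_comp_subtypeL_ker_orthogonal] at hF ⊢
  exact closed_complemented_range_of_isCompl_of_ker_eq_bot _ F hF
    F.closed_of_finiteDimensional f.ker_comp_subtypeL_ker_orthogonal

theorem exists_comp_eq_id_of_surjective [CompleteSpace G] (f : H →L[ℂ] G) (hf : Function.Surjective f) :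
    ∃ g : G →L[ℂ] H, f ∘L g = ContinuousLinearMap.id ℂ G := by
  let e := ContinuousLinearEquiv.ofBijective (f ∘L f.kerᗮ.subtypeL)
    f.ker_comp_subtypeL_ker_orthogonal
    (f.range_comp_subtypeL_ker_orthogonal.trans (LinearMap.range_eq_top.2 hf))
  refine ⟨f.kerᗮ.subtypeL ∘L (e.symm : G →L[ℂ] f.kerᗮ), ?_⟩
  ext y
  exact e.apply_symm_apply y

end ContinuousLinearMap

end Hilbert


/-! ### Semi-Browder operators and triangular forms. -/

namespace SamuelMultiplicity

section Normed

variable {E : Type*} [NormedAddCommGroup E] [NormedSpace ℂ E]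

theorem isLowerSemiFredholm_iff (T : E →L[ℂ] E) :
    IsLowerSemiFredholm T ↔ Module.Finite ℂ (E ⧸ LinearMap.range T.toLinearMap) := by
  rw [IsLowerSemiFredholm, deficiency, Cardinal.toENat_lt_top, Module.rank_lt_aleph0_iff]

theorem descent_lt_top_iff (T : E →L[ℂ] E) :
    descent T < ⊤ ↔ ∃ k : ℕ,
      LinearMap.range (T ^ k).toLinearMap = LinearMap.range (T ^ (k + 1)).toLinearMap := by
  simp only [descent, iInf_lt_iff, Set.mem_ofPred_eq, ENat.natCast_lt_top, exists_prop, and_true]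

theorem IsRightInvertible.surjective {T : E →L[ℂ] E} (h : IsRightInvertible T) :
    Function.Surjective T := by
  obtain ⟨S, hS⟩ := h
  exact fun y => ⟨S y, DFunLike.congr_fun hS y⟩

theorem surjective_pow {T : E →L[ℂ] E} (hT : Function.Surjective T) (k : ℕ) :
    Function.Surjective (T ^ k) := by
  rw [FunLike.coe_pow_eq_iterate]
  exact hT.iterate k

theorem nullity_lt_top [FiniteDimensional ℂ E] (T : E →L[ℂ] E) : nullity T < ⊤ :=
  Cardinal.toENat_lt_top.2 (Module.rank_lt_aleph0 ℂ _)

end Normed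

section UpperTriangular

variable {H : Type*} [NormedAddCommGroup H] [InnerProductSpace ℂ H] {T : H →L[ℂ] H}
  {H₁ H₂ : Submodule ℂ H} {T₁ : H₁ →L[ℂ] H₁} {T₁₂ : H₂ →L[ℂ] H₁} {T₂ : H₂ →L[ℂ] H₂}

namespace IsUpperTriangularForm

theorem isCompl (h : IsUpperTriangularForm T H₁ H₂ T₁ T₁₂ T₂) : IsCompl H₂ H₁ :=
  ⟨h.orthogonal.disjoint.symm, codisjoint_iff.2 (sup_comm H₁ H₂ ▸ h.sup_eq_top)⟩

theorem apply_left (h : IsUpperTriangularForm T H₁ H₂ T₁ T₁₂ T₂) (x : H₁) :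
    T x = T₁ x := by
  simpa using h.apply_add x 0

theorem pow_apply_left (h : IsUpperTriangularForm T H₁ H₂ T₁ T₁₂ T₂) (k : ℕ) (x : H₁) :
    (T ^ k) x = (T₁ ^ k) x := by
  induction k generalizing x with
  | zero => rfl
  | succ k ih =>
    rw [pow_succ, pow_succ, mul_apply_eq_comp, mul_apply_eq_comp,
      h.apply_left, ih]

theorem projectionOnto_apply (h : IsUpperTriangularForm T H₁ H₂ T₁ T₁₂ T₂) (z : H) :
    Submodule.projectionOnto H₂ H₁ h.isCompl (T z) =
      T₂ (Submodule.projectionOnto H₂ H₁ h.isCompl z) := by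
  have hz : z ∈ H₁ ⊔ H₂ := h.sup_eq_top ▸ Submodule.mem_top
  obtain ⟨x, hx, y, hy, rfl⟩ := Submodule.mem_sup.1 hz
  lift x to H₁ using hx
  lift y to H₂ using hy
  rw [h.apply_add x y]
  simp

theorem projectionOnto_pow_apply (h : IsUpperTriangularForm T H₁ H₂ T₁ T₁₂ T₂) (k : ℕ) (z : H) :
    Submodule.projectionOnto H₂ H₁ h.isCompl ((T ^ k) z) =
      (T₂ ^ k) (Submodule.projectionOnto H₂ H₁ h.isCompl z) := by
  induction k generalizing z with
  | zero => rfl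
  | succ k ih =>
    rw [pow_succ, pow_succ, mul_apply_eq_comp, mul_apply_eq_comp,
      ih, h.projectionOnto_apply]

theorem range_subtype_eq_ker (h : IsUpperTriangularForm T H₁ H₂ T₁ T₁₂ T₂) :
    LinearMap.range H₁.subtype = LinearMap.ker (Submodule.projectionOnto H₂ H₁ h.isCompl) := by
  rw [Submodule.range_subtype, Submodule.ker_projectionOnto]

/-- Once `T₂ ^ k = 0` the range no longer depends on `k`, which gives finite descent. -/
theorem range_pow_eq (h : IsUpperTriangularForm T H₁ H₂ T₁ T₁₂ T₂)
    (hT₁ : Function.Surjective T₁) {k : ℕ} (hk : T₂ ^ k = 0) :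
    LinearMap.range (T ^ k).toLinearMap = H₁ := by
  apply le_antisymm
  · rintro _ ⟨x, rfl⟩
    rw [← Submodule.range_subtype H₁, h.range_subtype_eq_ker, LinearMap.mem_ker]
    refine (h.projectionOnto_pow_apply k x).trans ?_
    rw [hk]
    rfl
  · intro x hx
    have hs := surjective_pow hT₁ k
    obtain ⟨y, hy⟩ := hs ⟨x, hx⟩
    refine ⟨y, (h.pow_apply_left k y).trans ?_⟩
    rw [hy]

theorem nullity_pow (h : IsUpperTriangularForm T H₁ H₂ T₁ T₁₂ T₂)
    (hT₁ : Function.Surjective T₁) (k : ℕ) :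
    nullity (T ^ k) = nullity (T₂ ^ k) + k * nullity T₁ := by
  have hs := surjective_pow hT₁ k
  have hr := LinearMap.rank_ker_of_exact (i := H₁.subtype)
    (p := Submodule.projectionOnto H₂ H₁ h.isCompl) (fA := (T₁ ^ k).toLinearMap)
    (fB := (T ^ k).toLinearMap) (fC := (T₂ ^ k).toLinearMap) H₁.injective_subtype
    (LinearMap.range_eq_top.1 (Submodule.range_projectionOnto h.isCompl)) h.range_subtype_eq_ker
    (LinearMap.ext (h.pow_apply_left k)) (LinearMap.ext (h.projectionOnto_pow_apply k)) hs
  have hr' := Module.End.rank_ker_pow_of_surjective T₁.toLinearMap hT₁ k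
  rw [← ContinuousLinearMap.toLinearMap_pow] at hr'
  rw [nullity, nullity, nullity, hr, hr', map_add, map_mul, map_natCast]

theorem deficiency_eq [FiniteDimensional ℂ H₂] (h : IsUpperTriangularForm T H₁ H₂ T₁ T₁₂ T₂)
    (hT₁ : Function.Surjective T₁) : deficiency T = nullity T₂ := by
  rw [deficiency, nullity, LinearMap.rank_ker_eq_rank_quotient_range T₂.toLinearMap]
  congr 1
  exact LinearMap.rank_quotient_range_of_exact (i := H₁.subtype)
    (p := Submodule.projectionOnto H₂ H₁ h.isCompl) (fA := T₁.toLinearMap)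
    (LinearMap.range_eq_top.1 (Submodule.range_projectionOnto h.isCompl)) h.range_subtype_eq_ker
    (LinearMap.ext h.apply_left) (LinearMap.ext h.projectionOnto_apply) hT₁

theorem isLowerSemiBrowder [FiniteDimensional ℂ H₂] (h : IsUpperTriangularForm T H₁ H₂ T₁ T₁₂ T₂)
    (hT₁ : Function.Surjective T₁) (hT₂ : IsNilpotent T₂) : IsLowerSemiBrowder T := by
  refine ⟨?_, (descent_lt_top_iff T).2 ?_⟩
  · rw [IsLowerSemiFredholm, h.deficiency_eq hT₁]
    exact nullity_lt_top T₂
  · obtain ⟨k, hk⟩ := hT₂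
    exact ⟨k, (h.range_pow_eq hT₁ hk).trans
      (h.range_pow_eq hT₁ (by rw [pow_succ, hk, zero_mul])).symm⟩

theorem nullity_eq_index [FiniteDimensional ℂ H₂] (h : IsUpperTriangularForm T H₁ H₂ T₁ T₁₂ T₂)
    (hT₁ : Function.Surjective T₁) : (nullity T₁ : EReal) = index T := by
  have h1 := h.nullity_pow hT₁ 1
  simp only [pow_one, Nat.cast_one, one_mul] at h1
  obtain ⟨d, hd⟩ := ENat.ne_top_iff_exists.1 (nullity_lt_top T₂).ne
  have hd' : ((d : ℕ∞) : EReal) = ((d : ℝ) : EReal) := rfl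
  -- Only the finite `d = α(T₂)` is cancelled, so `α(T₁) = ∞` is allowed.
  rw [index, h.deficiency_eq hT₁, h1, ← hd, ENat.toENNReal_add, EReal.coe_ennreal_add,
    add_comm (((d : ℕ∞) : EReal)), hd', EReal.add_sub_cancel_right]

theorem tendsto_nullityQuotient [FiniteDimensional ℂ H₂]
    (h : IsUpperTriangularForm T H₁ H₂ T₁ T₁₂ T₂) (hT₁ : Function.Surjective T₁)
    (hT₂ : IsNilpotent T₂) : Tendsto (nullityQuotient T) atTop (𝓝 (nullity T₁ : EReal)) := by
  obtain ⟨n, hn⟩ := hT₂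
  -- Here `d = dim H₂`, the nullity of `T₂ ^ k = 0` for all `k ≥ n`.
  obtain ⟨d, hd⟩ := ENat.ne_top_iff_exists.1 (nullity_lt_top (0 : H₂ →L[ℂ] H₂)).ne
  have hev : ∀ᶠ k : ℕ in atTop,
      (nullity T₁ : EReal) + ((d / k : ℝ) : EReal) = nullityQuotient T k := by
    filter_upwards [eventually_ge_atTop n, eventually_gt_atTop 0] with k hk hk0
    rw [nullityQuotient, h.nullity_pow hT₁, pow_eq_zero_of_le hk hn, ← hd, ENat.toENNReal_add,
      EReal.coe_ennreal_add, EReal.add_div_of_nonneg_right (by positivity),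
      add_comm (((d : ℕ∞) : EReal) / (k : EReal))]
    congr 1
    have hk' : ((k : ℕ∞) : EReal) = (k : EReal) := rfl
    rw [ENat.toENNReal_mul, EReal.coe_ennreal_mul, hk', mul_comm, ← EReal.mul_div,
      EReal.div_self (EReal.natCast_ne_bot k) (EReal.natCast_ne_top k)
        (by exact_mod_cast hk0.ne'), mul_one]
  refine Tendsto.congr' hev ?_
  have hlim : Tendsto (fun k : ℕ => ((d / k : ℝ) : EReal)) atTop (𝓝 ((0 : ℝ) : EReal)) :=
    EReal.tendsto_coe.2 (tendsto_const_div_atTop_nhds_zero_nat (d : ℝ))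
  -- Addition is continuous here even if `α(T₁) = ∞`, because the other limit is finite.
  have := (EReal.continuousAt_add (p := ((nullity T₁ : EReal), ((0 : ℝ) : EReal)))
    (Or.inr (by simp)) (Or.inr (by simp))).tendsto.comp
      (tendsto_const_nhds.prodMk_nhds hlim)
  simpa [Function.comp_def] using this

end IsUpperTriangularForm

theorem IsLowerSemiBrowder.exists_isUpperTriangularForm [CompleteSpace H]
    (hT : IsLowerSemiBrowder T) :
    ∃ (H₁ H₂ : Submodule ℂ H) (T₁ : H₁ →L[ℂ] H₁) (T₁₂ : H₂ →L[ℂ] H₁) (T₂ : H₂ →L[ℂ] H₂),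
      IsUpperTriangularForm T H₁ H₂ T₁ T₁₂ T₂ ∧ FiniteDimensional ℂ H₂ ∧
        IsRightInvertible T₁ ∧ IsNilpotent T₂ := by
  obtain ⟨hfin, hdesc⟩ := hT
  rw [isLowerSemiFredholm_iff] at hfin
  obtain ⟨k, hk⟩ := (descent_lt_top_iff T).1 hdesc
  have hfink : Module.Finite ℂ (H ⧸ LinearMap.range (T ^ k).toLinearMap) := by
    rw [ContinuousLinearMap.toLinearMap_pow]
    exact Module.End.finite_quotient_range_pow _ k
  have hclosed := (T ^ k).isClosed_range_of_finite_quotient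
  obtain ⟨M, hM⟩ : ∃ M, M = LinearMap.range (T ^ k).toLinearMap := ⟨_, rfl⟩
  have hmem (x : H) : (T ^ k) x ∈ M := hM ▸ ⟨x, rfl⟩
  have hinv : ∀ x ∈ M, T x ∈ M := by
    intro x hx
    rw [hM] at hx
    obtain ⟨y, rfl⟩ := hx
    rw [hM, hk]
    refine ⟨y, ?_⟩
    rw [pow_succ']
    rfl
  rw [← hM] at hfink hclosed
  have : CompleteSpace M := hclosed.completeSpace_coe
  have hadd (x : H) : x = M.orthogonalProjectionOnto x + Mᗮ.orthogonalProjectionOnto x := by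
    exact (M.starProjection_add_starProjection_orthogonal x).symm
  let T₁ : M →L[ℂ] M := (T ∘L M.subtypeL).codRestrict M fun x => hinv x x.2
  let T₁₂ : Mᗮ →L[ℂ] M := M.orthogonalProjectionOnto ∘L T ∘L Mᗮ.subtypeL
  let T₂ : Mᗮ →L[ℂ] Mᗮ := Mᗮ.orthogonalProjectionOnto ∘L T ∘L Mᗮ.subtypeL
  have hform : IsUpperTriangularForm T M Mᗮ T₁ T₁₂ T₂ := by
    refine ⟨M.isOrtho_orthogonal_right, Submodule.sup_orthogonal_of_hasOrthogonalProjection, ?_⟩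
    intro x y
    rw [map_add, Submodule.coe_add, add_assoc]
    congr 1
    exact hadd (T y)
  have hsurj : Function.Surjective T₁ := by
    rintro ⟨y, hy⟩
    rw [hM, hk] at hy
    obtain ⟨x, hx⟩ := hy
    -- Since `y = T ^ (k + 1) x`, the vector `T ^ k x` is a preimage of `y` lying in `M`.
    refine ⟨⟨(T ^ k) x, hmem x⟩, Subtype.ext ?_⟩
    rw [pow_succ'] at hx
    exact hx
  refine ⟨M, Mᗮ, T₁, T₁₂, T₂, hform, ?_, T₁.exists_comp_eq_id_of_surjective hsurj, k, ?_⟩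
  · exact Module.Finite.equiv (Submodule.quotientEquivOfIsCompl _ _
      M.isCompl_orthogonal)
  · ext1 y
    -- The `Mᗮ` component of `T ^ k y` is `T₂ ^ k y`, and it vanishes because `T ^ k y ∈ M`.
    have hy := hform.projectionOnto_pow_apply k (y : H)
    rw [Submodule.projectionOnto_apply_left,
      (Submodule.projectionOnto_apply_eq_zero_iff _).2 (hmem y)] at hy
    exact hy.symm

end UpperTriangular

end SamuelMultiplicity

theorem proposition1p8 {H : Type*} [NormedAddCommGroup H] [InnerProductSpace ℂ H]
    [CompleteSpace H] [TopologicalSpace.SeparableSpace H] (hH : ¬ FiniteDimensional ℂ H)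
    (T : H →L[ℂ] H) :
    (SamuelMultiplicity.IsLowerSemiBrowder T ↔
      ∃ (H₁ H₂ : Submodule ℂ H) (T₁ : H₁ →L[ℂ] H₁) (T₁₂ : H₂ →L[ℂ] H₁) (T₂ : H₂ →L[ℂ] H₂),
        SamuelMultiplicity.IsUpperTriangularForm T H₁ H₂ T₁ T₁₂ T₂ ∧
        FiniteDimensional ℂ H₂ ∧
        SamuelMultiplicity.IsRightInvertible T₁ ∧
        IsNilpotent T₂) ∧
    (∀ (H₁ H₂ : Submodule ℂ H) (T₁ : H₁ →L[ℂ] H₁) (T₁₂ : H₂ →L[ℂ] H₁) (T₂ : H₂ →L[ℂ] H₂),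
      SamuelMultiplicity.IsUpperTriangularForm T H₁ H₂ T₁ T₁₂ T₂ →
      FiniteDimensional ℂ H₂ →
      SamuelMultiplicity.IsRightInvertible T₁ →
      IsNilpotent T₂ →
        Tendsto (SamuelMultiplicity.nullityQuotient T) atTop
          (𝓝 (SamuelMultiplicity.bsMul T)) ∧
        (SamuelMultiplicity.nullity T₁ : EReal) = SamuelMultiplicity.bsMul T ∧
        SamuelMultiplicity.bsMul T = SamuelMultiplicity.index T) := by
  refine ⟨⟨fun h => h.exists_isUpperTriangularForm, ?_⟩, ?_⟩
  · rintro ⟨H₁, H₂, T₁, T₁₂, T₂, h, hfin, hT₁, hT₂⟩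
    exact h.isLowerSemiBrowder hT₁.surjective hT₂
  · intro H₁ H₂ T₁ T₁₂ T₂ h hfin hT₁ hT₂
    have hlim := h.tendsto_nullityQuotient hT₁.surjective hT₂
    have hmul : SamuelMultiplicity.bsMul T = (SamuelMultiplicity.nullity T₁ : EReal) :=
      hlim.limUnder_eq
    rw [hmul]
    exact ⟨hlim, rfl, h.nullity_eq_index hT₁.surjective⟩
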